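/- Let $R$ be an integral domain and $a,b,c,d\in R$ (for example $R=\mathbb{Z}[a,b,c,d]$ with $a,b,c,d$ indeterminates). For a partition $\lambda=(\lambda_1\ge\lambda_2\ge\cdots)$ put $$\omega(\lambda)=a^{\sum_{i\ge1}\lceil\lambda_{2i-1}/2\rceil}\,b^{\sum_{i\ge1}\lfloor\lambda_{2i-1}/2\rfloor}\,c^{\sum_{i\ge1}\lceil\lambda_{2i}/2\rceil}\,d^{\sum_{i\ge1}\lfloor\lambda_{2i}/2\rfloor}.$$ For $n\ge0$ let $X=X_{2n}=(x_1,\dots,x_{2n})$ be variables and let $$z_n(X_{2n})=\sum_{\ell(\lambda)\le 2n}\omega(\lambda)\,s_\lambda(x_1,\dots,x_{2n})\in R[[x_1,\dots,x_{2n}]],$$ where the sum runs over all partitions $\lambda$ with at most $2n$ parts and $s_\lambda(x_1,\dots,x_{2n})=\det\bigl(x_i^{\lambda_j+2n-j}\bigr)_{1\le i,j\le 2n}\big/\det\bigl(x_i^{2n-j}\bigr)_{1\le i,j\le 2n}$ is the Schur polynomial. For $2n$-tuples $X,Y,A,B$ with entries $x_i,y_i,a_i,b_i$ in a commutative ring,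 let $V^n(X,Y;A,B)$ be the determinant of the $2n\times 2n$ matrix whose $(i,j)$ entry is $a_i x_i^{n-j}y_i^{j-1}$ if $1\le j\le n$, and $b_i x_i^{2n-j}y_i^{j-n-1}$ if $n+1\le j\le 2n$. Then the denominator on the right-hand side below is nonzero in $R[[x_1,\dots,x_{2n}]]$, and in the field of fractions of $R[[x_1,\dots,x_{2n}]]$ one has $$z_n(X_{2n})=(-1)^{\binom n2}\,\frac{V^n\bigl(X^2,\ \mathbf 1+abcd\,X^4;\ X+aX^2,\ \mathbf 1-a(b+c)X^2-abc\,X^3\bigr)}{\prod_{i=1}^{2n}(1-abx_i^2)\ \prod_{1\le i<j\le 2n}(x_i-x_j)(1-abcd\,x_i^2x_j^2)},$$ where $X^2=(x_i^2)_i$, $\mathbf 1+abcd\,X^4=(1+abcd\,x_i^4)_i$, $X+aX^2=(x_i+ax_i^2)_i$ and $\mathbf 1-a(b+c)X^2-abc\,X^3=(1-a(b+c)x_i^2-abc\,x_i^3)_i$, for $1\le i\le 2n$. -/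

import Mathlib

noncomputable section

open Finset

namespace StanleySchur

/-- The alternant `det (x_i ^ α_j)` in the variables `x_0, …, x_{m-1}`. -/
def alternant (m : ℕ) (α : Fin m → ℕ) : MvPolynomial (Fin m) ℤ :=
  Matrix.det (Matrix.of fun i j : Fin m => (MvPolynomial.X i : MvPolynomial (Fin m) ℤ) ^ α j)

/-- The staircase `δ = (m-1, m-2, …, 1, 0)`. -/
def delta (m : ℕ) : Fin m → ℕ := fun j => m - 1 - (j : ℕ)

/-- Partitions are Young diagrams. `shifted m μ = μ + δ`, the first `m` parts of `μ` shifted by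
the staircase; the (0-based) `j`-th part of `μ` is `μ.rowLen j`. -/
def shifted (m : ℕ) (μ : YoungDiagram) : Fin m → ℕ := fun j => μ.rowLen j + delta m j

/-- Vandermonde's determinant: `det (x_i ^ (m-1-j)) = ∏_{i<j} (x_i - x_j)`. -/
theorem alternant_delta (m : ℕ) :
    alternant m (delta m) = ∏ i : Fin m, ∏ j ∈ Ioi i, (MvPolynomial.X i - MvPolynomial.X j) := by
  have h := Matrix.det_projVandermonde (R := MvPolynomial (Fin m) ℤ)
    (fun _ => 1) (fun i => MvPolynomial.X i)
  have h2 : alternant m (delta m) = (Matrix.projVandermonde (R := MvPolynomial (Fin m) ℤ)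
      (fun _ => 1) (fun i => MvPolynomial.X i)).det := by
    unfold alternant
    congr 1
    ext1 i j
    simp only [Matrix.of_apply, Matrix.projVandermonde_apply, one_pow, one_mul]
    congr 1
    simp [delta, Fin.val_rev]
    omega
  rw [h2, h]
  simp

theorem alternant_delta_ne_zero (m : ℕ) : alternant m (delta m) ≠ 0 := by
  rw [alternant_delta]
  refine prod_ne_zero_iff.2 fun i _ => prod_ne_zero_iff.2 fun j hj => ?_
  rw [sub_ne_zero]
  intro h
  exact (mem_Ioi.1 hj).ne (MvPolynomial.X_injective h)

/-- Every alternant is divisible by the Vandermonde determinant. -/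
theorem alternant_delta_dvd (m : ℕ) (α : Fin m → ℕ) :
    alternant m (delta m) ∣ alternant m α := by
  classical
  let Q : Polynomial (MvPolynomial (Fin m) ℤ) :=
    ∏ k : Fin m, (Polynomial.X - Polynomial.C (MvPolynomial.X k))
  have hQ : Q.Monic := Polynomial.monic_prod_of_monic _ _ fun k _ => Polynomial.monic_X_sub_C _
  have hQd : Q.natDegree = m := by
    simp [Q, Polynomial.natDegree_prod_of_monic _ _
      fun (k : Fin m) _ => Polynomial.monic_X_sub_C (MvPolynomial.X k : MvPolynomial (Fin m) ℤ)]
  let r : ℕ → Polynomial (MvPolynomial (Fin m) ℤ) := fun e => (Polynomial.X ^ e) %ₘ Q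
  have hr : ∀ e (i : Fin m), (r e).eval (MvPolynomial.X i) = (MvPolynomial.X i) ^ e := by
    intro e i
    have h := congrArg (Polynomial.eval (MvPolynomial.X i : MvPolynomial (Fin m) ℤ))
      (Polynomial.modByMonic_add_div (Polynomial.X ^ e) Q)
    have h0 : Q.eval (MvPolynomial.X i) = 0 := by
      simp only [Q, Polynomial.eval_prod]
      exact prod_eq_zero (mem_univ i) (by simp)
    simpa [h0] using h
  have hdeg : ∀ e (i : Fin m), (r e).eval (MvPolynomial.X i)
      = ∑ k ∈ range m, (r e).coeff k * (MvPolynomial.X i) ^ k := by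
    intro e i
    have hm : 0 < m := i.pos
    refine Polynomial.eval_eq_sum_range' ?_ _
    have := Polynomial.natDegree_modByMonic_lt (Polynomial.X ^ e) hQ
      (fun h1 => by rw [h1, Polynomial.natDegree_one] at hQd; omega)
    rwa [hQd] at this
  refine ⟨Matrix.det (Matrix.of fun k j : Fin m => (r (α j)).coeff (delta m k)), ?_⟩
  unfold alternant
  rw [← Matrix.det_mul]
  congr 1
  ext1 i j
  rw [Matrix.of_apply, ← hr, hdeg, Matrix.mul_apply, ← Finset.sum_range_reflect,
    ← Fin.sum_univ_eq_sum_range (fun k => (r (α j)).coeff (m - 1 - k) *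
      (MvPolynomial.X i : MvPolynomial (Fin m) ℤ) ^ (m - 1 - k)) m]
  exact sum_congr rfl fun k _ => mul_comm _ _

/-- The Schur polynomial `s_μ(x_0, …, x_{m-1})`: the quotient of the alternants
`det (x_i ^ (μ_j + m-1-j))` and `det (x_i ^ (m-1-j))` if `μ` has at most `m` parts, and `0`
otherwise. -/
def schur (m : ℕ) (μ : YoungDiagram) : MvPolynomial (Fin m) ℤ :=
  if μ.colLen 0 ≤ m then Classical.choose (alternant_delta_dvd m (shifted m μ)) else 0

/-- The equation that determines the Schur polynomial (see also `alternant_delta_ne_zero`). -/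
theorem alternant_delta_mul_schur (m : ℕ) (μ : YoungDiagram) (h : μ.colLen 0 ≤ m) :
    alternant m (delta m) * schur m μ = alternant m (shifted m μ) := by
  rw [schur, if_pos h]
  exact (Classical.choose_spec (alternant_delta_dvd m (shifted m μ))).symm

section Weight

variable {R : Type*} [CommRing R]

/-- Stanley's weight
`ω(μ) = a^{∑ ⌈μ_{2i-1}/2⌉} b^{∑ ⌊μ_{2i-1}/2⌋} c^{∑ ⌈μ_{2i}/2⌉} d^{∑ ⌊μ_{2i}/2⌋}` (parts numbered
from `1`, so that `μ_{2i-1}` is `μ.rowLen (2 * (i - 1))`). The sums stop at the number of parts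
of `μ`, beyond which all parts are `0`. -/
def omega (a b c d : R) (μ : YoungDiagram) : R :=
  a ^ (∑ i ∈ range (μ.colLen 0), ⌈(μ.rowLen (2 * i) : ℚ) / 2⌉₊) *
  b ^ (∑ i ∈ range (μ.colLen 0), ⌊(μ.rowLen (2 * i) : ℚ) / 2⌋₊) *
  c ^ (∑ i ∈ range (μ.colLen 0), ⌈(μ.rowLen (2 * i + 1) : ℚ) / 2⌉₊) *
  d ^ (∑ i ∈ range (μ.colLen 0), ⌊(μ.rowLen (2 * i + 1) : ℚ) / 2⌋₊)

/-- The coefficient of `x^e` in `ω(μ) s_μ(x_0, …, x_{m-1})`. -/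
def termCoeff (a b c d : R) (m : ℕ) (e : Fin m →₀ ℕ) (μ : YoungDiagram) : R :=
  omega a b c d μ * ((MvPolynomial.coeff e (schur m μ) : ℤ) : R)

/-- The formal power series `∑_{ℓ(μ) ≤ m} ω(μ) s_μ(x_0, …, x_{m-1})`, over all partitions `μ`
with at most `m` parts, summed coefficient by coefficient. All these sums are finite, by
`finite_support_termCoeff`. -/
def weightedSchurSum (a b c d : R) (m : ℕ) : MvPowerSeries (Fin m) R :=
  fun e => ∑ᶠ μ : {μ : YoungDiagram // μ.colLen 0 ≤ m}, termCoeff a b c d m e μ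

/-- `z_n(X_{2n}) = ∑_{ℓ(μ) ≤ 2n} ω(μ) s_μ(x_1, …, x_{2n})`. -/
def z (a b c d : R) (n : ℕ) : MvPowerSeries (Fin (2 * n)) R :=
  weightedSchurSum a b c d (2 * n)

/-- `V^n(X, Y; A, B)`: the determinant of the `2n × 2n` matrix whose row `i` is
`a_i x_i^{n-1}, a_i x_i^{n-2} y_i, …, a_i y_i^{n-1}, b_i x_i^{n-1}, b_i x_i^{n-2} y_i, …,
b_i y_i^{n-1}`. -/
def V (n : ℕ) (X Y A B : Fin (2 * n) → R) : R :=
  Matrix.det (Matrix.of fun i j : Fin (2 * n) =>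
    if (j : ℕ) < n then A i * X i ^ (n - 1 - (j : ℕ)) * Y i ^ (j : ℕ)
    else B i * X i ^ (2 * n - 1 - (j : ℕ)) * Y i ^ ((j : ℕ) - n))

end Weight

theorem alternant_isHomogeneous (m : ℕ) (α : Fin m → ℕ) :
    (alternant m α).IsHomogeneous (∑ j, α j) := by
  unfold alternant
  rw [Matrix.det_apply]
  refine MvPolynomial.IsHomogeneous.sum _ _ _ fun σ _ => ?_
  have h : (∏ i, (Matrix.of fun i j : Fin m =>
      (MvPolynomial.X i : MvPolynomial (Fin m) ℤ) ^ α j) (σ i) i).IsHomogeneous (∑ j, α j) := by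
    refine MvPolynomial.IsHomogeneous.prod _ _ _ fun i _ => ?_
    simpa using (MvPolynomial.isHomogeneous_X ℤ (σ i)).pow (α i)
  rcases Int.units_eq_one_or (Equiv.Perm.sign σ) with h1 | h1 <;> rw [h1]
  · simpa using h
  · simpa using h.neg

/-- `s_μ(x_0, …, x_{m-1})` is homogeneous of degree `μ_0 + ⋯ + μ_{m-1}`. -/
theorem schur_isHomogeneous (m : ℕ) (μ : YoungDiagram) :
    (schur m μ).IsHomogeneous (∑ j : Fin m, μ.rowLen j) := by
  by_cases hμ : μ.colLen 0 ≤ m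
  swap
  · rw [schur, if_neg hμ]
    exact MvPolynomial.isHomogeneous_zero _ _ _
  have hd := alternant_isHomogeneous m (delta m)
  have hs := alternant_isHomogeneous m (shifted m μ)
  rw [← alternant_delta_mul_schur m μ hμ] at hs
  have key : ∀ k, k ≠ ∑ j : Fin m, μ.rowLen j →
      MvPolynomial.homogeneousComponent k (schur m μ) = 0 := by
    intro k hk
    let _ := MvPolynomial.gradedAlgebra (σ := Fin m) (R := ℤ)
    have h1 := DirectSum.coe_decompose_mul_add_of_left_mem
      (MvPolynomial.homogeneousSubmodule (Fin m) ℤ) (i := ∑ j, delta m j) (j := k)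
      (b := schur m μ) hd
    have h2 : MvPolynomial.homogeneousComponent ((∑ j, delta m j) + k)
        (alternant m (delta m) * schur m μ) = 0 := by
      rw [MvPolynomial.homogeneousComponent_of_mem hs, if_neg]
      simp only [shifted, sum_add_distrib]
      omega
    have h1' : MvPolynomial.homogeneousComponent ((∑ j, delta m j) + k)
        (alternant m (delta m) * schur m μ) =
        alternant m (delta m) * MvPolynomial.homogeneousComponent k (schur m μ) :=
      (MvPolynomial.decomposition.decompose'_apply _ _).symm.trans
        (h1.trans (congrArg _ (MvPolynomial.decomposition.decompose'_apply _ _)))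
    have h3 := h1'.symm.trans h2
    exact (mul_eq_zero.1 h3).resolve_left (alternant_delta_ne_zero m)
  rw [← MvPolynomial.sum_homogeneousComponent (schur m μ)]
  refine MvPolynomial.IsHomogeneous.sum _ _ _ fun k _ => ?_
  by_cases hk : k = ∑ j : Fin m, μ.rowLen j
  · rw [hk]
    exact MvPolynomial.homogeneousComponent_isHomogeneous _ _
  · rw [key k hk]
    exact MvPolynomial.isHomogeneous_zero _ _ _

/-- Every monomial occurs in only finitely many of the polynomials `ω(μ) s_μ`. -/
theorem finite_support_termCoeff {R : Type*} [CommRing R] (a b c d : R) (m : ℕ)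
    (e : Fin m →₀ ℕ) :
    (Function.support fun μ : {μ : YoungDiagram // μ.colLen 0 ≤ m} =>
      termCoeff a b c d m e μ).Finite := by
  have hfin : {μ : {μ : YoungDiagram // μ.colLen 0 ≤ m} |
      (μ : YoungDiagram).cells ∈ (range m ×ˢ range e.degree).powerset}.Finite := by
    refine Set.Finite.preimage ?_ (Finset.finite_toSet _)
    intro μ _ ν _ h
    exact Subtype.ext (YoungDiagram.ext h)
  refine hfin.subset fun μ hμ => ?_
  have hc : MvPolynomial.coeff e (schur m μ) ≠ 0 := by
    intro h
    exact hμ (by simp [termCoeff, h])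
  have hdeg : e.degree = ∑ j : Fin m, (μ : YoungDiagram).rowLen j := by
    by_contra h
    exact hc ((schur_isHomogeneous m μ).coeff_eq_zero h)
  simp only [Set.mem_ofPred_eq, mem_powerset]
  rintro ⟨i, j⟩ hij
  rw [YoungDiagram.mem_cells] at hij
  have hi : i < m := by
    have h0 : (i, 0) ∈ (μ : YoungDiagram) :=
      YoungDiagram.up_left_mem _ le_rfl (Nat.zero_le _) hij
    exact (YoungDiagram.mem_iff_lt_colLen.1 h0).trans_le μ.2
  have hj := YoungDiagram.mem_iff_lt_rowLen.1 hij
  have hle : (μ : YoungDiagram).rowLen i ≤ ∑ j : Fin m, (μ : YoungDiagram).rowLen j :=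
    single_le_sum (f := fun j : Fin m => (μ : YoungDiagram).rowLen j)
      (fun _ _ => Nat.zero_le _) (mem_univ (⟨i, hi⟩ : Fin m))
  simp only [mem_product, mem_range]
  exact ⟨hi, by omega⟩

end StanleySchur

end

/-! Write t = abcd. Multiplied by the Vandermonde determinant, z_n becomes a sum of alternants
det(x_i^{l_j}) over strictly decreasing sequences l = λ + δ. Up to the factor t^{n choose 2}, ω(λ)
is a product of factors α(l_1) β(l_2) α(l_3) ⋯ depending on single entries (`altWeight_shifted`).

Put e_p = (x_i^p)_i. In the exterior algebra, the n-th power of the 2-form ∑_{q<p} α_p β_q e_p ∧ e_q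
is n! times the sum of all α(l_1) β(l_2) ⋯ e_{l_1} ∧ ⋯ ∧ e_{l_{2n}} (`partialForm_pow`). Its top
coefficient is a Pfaffian, written as `pairSum`, in the coefficients c_ij = ∑_{q<p} α_p β_q x_i^p
x_j^q (`factorial_mul_sum_altWeight`).

The weights are geometric with period 2, so c_ij is rational with denominator (1 - ab x_i²)(1 - t
x_i² x_j²). Only c_ij - c_ji matters (`pairSum_congr`); hence, after multiplication by ∏(1 - ab
x_i²), c_ij may be replaced by A_i B_j / (1 - t x_i² x_j²), with A and B the row factors of V^n.
Both this Pfaffian and V^n are signed sums over splittings of the variables into two halves, one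
with Cauchy determinants and the other with products of two Vandermonde determinants. They agree
term by term (`prod_mul_pairSum`), because XY' - X'Y = (X - X')(1 - tXX') for Y = 1 + tX², Y' = 1 +
tX'².

Infinite sums are truncated modulo power series of high degree. The argument cancels n! and a power
of t, so it is run over ℤ[a,b,c,d] and then specialized. -/

noncomputable section
open Finset
namespace StanleySchur

/-! ### Cauchy's determinant. -/

/-- Cauchy's determinant `det (1 / (1 - t x_i y_j))`, with the inverses given as `h i j`. -/
theorem det_cauchy {S : Type*} [CommRing S] (t : S) : ∀ (n : ℕ) (X Y : Fin n → S)
    (h : Fin n → Fin n → S), (∀ i j, h i j * (1 - t * X i * Y j) = 1) →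
    Matrix.det (Matrix.of h) = t ^ n.choose 2 *
      (∏ i, ∏ j ∈ Ioi i, (X j - X i) * (Y j - Y i)) * ∏ i, ∏ j, h i j
  | 0, _, _, _, _ => by simp
  | n + 1, X, Y, h, hh => by
    have ih := det_cauchy t n (fun i => X i.succ) (fun i => Y i.succ)
      (fun i j => h i.succ j.succ) fun i j => hh _ _
    -- Subtracting row 0 splits off the row factor t (X_i - X_0) and the column factor h_0j. In the
    -- remaining matrix `C`, subtracting column 0 then clears row 0 and leaves a smaller Cauchy
    -- matrix, by `e2`.
    have e1 : ∀ i j, h i j - h 0 j = t * (X i - X 0) * Y j * h i j * h 0 j := fun i j => by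
      linear_combination h 0 j * hh i j - h i j * hh 0 j
    have e2 : ∀ i j, Y j * h i j - Y 0 * h i 0 = (Y j - Y 0) * h i j * h i 0 := fun i j => by
      linear_combination Y 0 * h i 0 * hh i j - Y j * h i j * hh i 0
    let C : Matrix (Fin (n + 1)) (Fin (n + 1)) S :=
      Matrix.of fun i j => Fin.cases 1 (fun i => Y j * h i.succ j) i
    let r : Fin (n + 1) → S := fun i => Fin.cases 1 (fun i => t * (X i.succ - X 0)) i
    let D : Matrix (Fin (n + 1)) (Fin (n + 1)) S :=
      Matrix.of fun i j => Fin.cases (C i 0) (fun j => C i j.succ - C i 0) j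
    have h1 : Matrix.det (Matrix.of h) = Matrix.det (Matrix.of fun i j => h 0 j *
        (Matrix.of fun i j => r i * C i j : Matrix _ _ S) i j) := by
      refine Matrix.det_eq_of_forall_row_eq_smul_add_const (Fin.cases 0 fun _ => 1) 0 rfl ?_
      intro i j
      refine Fin.cases ?_ (fun i => ?_) i
      · simp [r, C]
      · have := e1 i.succ j
        simp only [Matrix.of_apply, Fin.cases_succ, Fin.cases_zero, r, C]
        linear_combination this
    have h2 : Matrix.det C = Matrix.det D := by
      rw [← Matrix.det_transpose C, ← Matrix.det_transpose D]
      refine Matrix.det_eq_of_forall_row_eq_smul_add_const (Fin.cases 0 fun _ => 1) 0 rfl ?_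
      intro j i
      refine Fin.cases ?_ (fun j => ?_) j <;> simp [D]
    have h3 : Matrix.det D = (∏ i : Fin n, (Y i.succ - Y 0) * h i.succ 0) *
        Matrix.det (Matrix.of fun i j : Fin n => h i.succ j.succ) := by
      rw [Matrix.det_succ_row_zero, Finset.sum_eq_single 0]
      · have : D.submatrix Fin.succ (Fin.succAbove 0) = Matrix.of fun i j : Fin n =>
            (Y j.succ - Y 0) * (Matrix.of fun i j : Fin n => h i.succ 0 *
              (Matrix.of fun i j : Fin n => h i.succ j.succ) i j) i j := by
          ext i j
          have := e2 i.succ j.succ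
          simp only [D, C, Matrix.submatrix_apply, Matrix.of_apply, Fin.succAbove_zero,
            Fin.cases_succ]
          linear_combination this
        rw [this, Matrix.det_mul_row, Matrix.det_mul_column, prod_mul_distrib]
        simp [D, C]
        ring
      · intro j _ hj
        obtain ⟨j, rfl⟩ := Fin.exists_succ_eq.2 hj
        simp [D, C]
      · simp
    rw [h1, Matrix.det_mul_row, Matrix.det_mul_column, h2, h3, ih]
    simp only [Fin.prod_univ_succ (n := n), Fin.cases_zero, Fin.cases_succ, r, prod_mul_distrib,
      prod_const, card_univ, Fintype.card_fin, Fin.prod_Ioi_zero, Fin.prod_Ioi_succ,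
      Nat.choose_succ_succ' n 1, Nat.choose_one_right, pow_add]
    ring

/-! ### Products over pairs of indices. -/

theorem prod_Ioi_comp_perm {M : Type*} [CommMonoid M] {m : ℕ} (s : Fin m → Fin m → M)
    (hs : ∀ i j, s i j = s j i) (σ : Equiv.Perm (Fin m)) :
    ∏ i, ∏ j ∈ Ioi i, s (σ i) (σ j) = ∏ i, ∏ j ∈ Ioi i, s i j := by
  rw [prod_sigma', prod_sigma']
  -- A pair i < j stands for an unordered pair, so its image under σ has to be put back in
  -- increasing order; the symmetry of s absorbs the swap.
  let φ : Equiv.Perm (Fin m) → (_ : Fin m) × Fin m → (_ : Fin m) × Fin m := fun σ p =>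
    if σ p.1 < σ p.2 then ⟨σ p.1, σ p.2⟩ else ⟨σ p.2, σ p.1⟩
  refine prod_bij' (fun p _ => φ σ p) (fun p _ => φ σ.symm p) ?_ ?_ ?_ ?_ ?_ <;>
    rintro ⟨i, j⟩ hij <;> simp only [mem_sigma, mem_univ, mem_Ioi, true_and] at hij ⊢
  · have := σ.injective.ne hij.ne
    simp only [φ]; split_ifs with h <;> simp <;> order
  · have := σ.symm.injective.ne hij.ne
    simp only [φ]; split_ifs with h <;> simp <;> order
  · simp only [φ]; split_ifs with h <;> simp_all [hij.not_gt]
  · simp only [φ]; split_ifs with h <;> simp_all [hij.not_gt]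
  · simp only [φ]; split_ifs with h
    · rfl
    · exact hs _ _

/-- The first and the second half of the indices `0, …, 2n-1`. -/
def halves (n : ℕ) : Fin n ⊕ Fin n ≃ Fin (2 * n) :=
  finSumFinEquiv.trans (finCongr (two_mul n).symm)

@[simp] theorem halves_inl_val (n : ℕ) (k : Fin n) : (halves n (Sum.inl k) : ℕ) = k := by
  simp [halves]

@[simp] theorem halves_inr_val (n : ℕ) (k : Fin n) : (halves n (Sum.inr k) : ℕ) = n + k := by
  simp [halves, add_comm]

theorem prod_Ioi_halves {M : Type*} [CommMonoid M] {n : ℕ} (s : Fin (2 * n) → Fin (2 * n) → M) :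
    ∏ i, ∏ j ∈ Ioi i, s i j =
      (∏ i : Fin n, ∏ j ∈ Ioi i, s (halves n (.inl i)) (halves n (.inl j))) *
      (∏ i : Fin n, ∏ j ∈ Ioi i, s (halves n (.inr i)) (halves n (.inr j))) *
      ∏ i : Fin n, ∏ j : Fin n, s (halves n (.inl i)) (halves n (.inr j)) := by
  have key : ∀ {m : ℕ} (u : Fin m → Fin m → M),
      ∏ i, ∏ j ∈ Ioi i, u i j = ∏ i, ∏ j, if i < j then u i j else 1 := fun u =>
    prod_congr rfl fun i _ => by
      rw [← prod_filter]
      exact prod_congr (by ext; simp) fun _ _ => rfl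
  rw [key, key, key, ← (halves n).prod_comp]
  rw [prod_congr rfl fun i _ => ((halves n).prod_comp _).symm]
  simp only [Fintype.prod_sum_type,
    Fin.lt_def, halves_inl_val, halves_inr_val, prod_mul_distrib]
  have h1 : ∀ i j : Fin n, ¬ (n + (i : ℕ) < j) := fun i j => by omega
  have h2 : ∀ i j : Fin n, (i : ℕ) < n + j := fun i j => by omega
  simp only [h1, h2, if_true, if_false, prod_const_one, mul_one, add_lt_add_iff_left]
  rw [mul_assoc, mul_comm (∏ _, ∏ _, s _ _)]

/-! ### Pairing sums and the determinant V^n. -/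

section Pairing

variable {S : Type*} [CommRing S]

/-- `∑_σ sgn σ ∏_k c (σ k) (σ (n + k))`: up to sign, `n!` times the Pfaffian of `c - cᵀ`. -/
def pairSum (n : ℕ) (c : Fin (2 * n) → Fin (2 * n) → S) : S :=
  ∑ σ : Equiv.Perm (Fin (2 * n)), ((Equiv.Perm.sign σ : ℤ) : S) *
    ∏ k : Fin n, c (σ (halves n (.inl k))) (σ (halves n (.inr k)))

/-- Permute the two halves separately. -/
def permHalves {n : ℕ} (τ ρ : Equiv.Perm (Fin n)) : Equiv.Perm (Fin (2 * n)) :=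
  (halves n).permCongr (Equiv.Perm.sumCongr τ ρ)

theorem sign_permHalves {n : ℕ} (τ ρ : Equiv.Perm (Fin n)) :
    Equiv.Perm.sign (permHalves τ ρ) = Equiv.Perm.sign τ * Equiv.Perm.sign ρ := by
  simp [permHalves]

/-- Summed over τ or ρ, the right-hand side turns products over a half into determinants; this is
the source of the factorials below. -/
theorem sum_sign_comp_permHalves {n : ℕ} (f : Equiv.Perm (Fin (2 * n)) → S)
    (τ ρ : Equiv.Perm (Fin n)) :
    ∑ σ : Equiv.Perm (Fin (2 * n)), ((Equiv.Perm.sign σ : ℤ) : S) * f σ =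
      ∑ σ : Equiv.Perm (Fin (2 * n)), ((Equiv.Perm.sign σ : ℤ) : S) *
        (((Equiv.Perm.sign τ : ℤ) : S) * ((Equiv.Perm.sign ρ : ℤ) : S) *
          f (σ * permHalves τ ρ)) := by
  rw [← Equiv.sum_comp (Equiv.mulRight (permHalves τ ρ))]
  refine sum_congr rfl fun σ _ => ?_
  simp only [Equiv.coe_mulRight, Equiv.Perm.sign_mul, sign_permHalves, Units.val_mul, Int.cast_mul]
  ring

/-- Averaging over the permutations of one half is enough to produce the determinant, hence a single
n!. -/
theorem factorial_mul_pairSum {n : ℕ} (A B : Fin (2 * n) → S) (h : Fin (2 * n) → Fin (2 * n) → S) :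
    (n.factorial : S) * pairSum n (fun i j => A i * B j * h i j) =
      ∑ σ : Equiv.Perm (Fin (2 * n)), ((Equiv.Perm.sign σ : ℤ) : S) *
        ((∏ k, A (σ (halves n (.inl k)))) * (∏ k, B (σ (halves n (.inr k)))) *
          Matrix.det (Matrix.of fun k m => h (σ (halves n (.inl k))) (σ (halves n (.inr m))))) := by
  have h1 : (n.factorial : S) * pairSum n (fun i j => A i * B j * h i j) =
      ∑ τ : Equiv.Perm (Fin n), pairSum n (fun i j => A i * B j * h i j) := by
    simp [Fintype.card_perm]
  rw [h1]
  simp only [pairSum]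
  rw [sum_congr rfl fun τ _ => sum_sign_comp_permHalves _ τ 1]
  rw [sum_comm]
  refine sum_congr rfl fun σ _ => ?_
  rw [← mul_sum, Matrix.det_apply']
  refine congrArg _ ?_
  rw [mul_sum]
  refine sum_congr rfl fun τ _ => ?_
  simp only [permHalves, Equiv.Perm.mul_apply, Equiv.permCongr_apply, Equiv.symm_apply_apply,
    Equiv.Perm.sumCongr_apply, Sum.map_inl, Sum.map_inr, prod_mul_distrib, Matrix.of_apply,
    Equiv.Perm.one_apply, Equiv.Perm.sign_one, Units.val_one, Int.cast_one]
  rw [Equiv.prod_comp τ fun k => A (σ (halves n (.inl k)))]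
  ring

/-- Laplace expansion along the first n and the last n columns: each minor is a homogeneous
Vandermonde determinant, and each splitting of the rows is counted n!² times. -/
theorem factorial_sq_mul_V {n : ℕ} (X Y A B : Fin (2 * n) → S) :
    (n.factorial : S) ^ 2 * V n X Y A B =
      ∑ σ : Equiv.Perm (Fin (2 * n)), ((Equiv.Perm.sign σ : ℤ) : S) *
        ((∏ k, A (σ (halves n (.inl k)))) * (∏ k, B (σ (halves n (.inr k)))) *
        ((∏ i : Fin n, ∏ j ∈ Ioi i, (X (σ (halves n (.inl i))) * Y (σ (halves n (.inl j))) -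
          X (σ (halves n (.inl j))) * Y (σ (halves n (.inl i))))) *
        (∏ i : Fin n, ∏ j ∈ Ioi i, (X (σ (halves n (.inr i))) * Y (σ (halves n (.inr j))) -
          X (σ (halves n (.inr j))) * Y (σ (halves n (.inr i))))))) := by
  have hV : ∀ u v : Fin n → S, ∏ i, ∏ j ∈ Ioi i, (u i * v j - u j * v i) =
      ∑ τ : Equiv.Perm (Fin n), ((Equiv.Perm.sign τ : ℤ) : S) *
        ∏ k, (u (τ k) ^ (n - 1 - (k : ℕ)) * v (τ k) ^ (k : ℕ)) := fun u v => by
    have := Matrix.det_projVandermonde v u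
    rw [Matrix.det_apply'] at this
    rw [prod_congr rfl fun i _ => prod_congr rfl fun j _ => (by ring :
      u i * v j - u j * v i = v j * u i - v i * u j), ← this]
    refine sum_congr rfl fun τ _ => congrArg _ (prod_congr rfl fun k _ => ?_)
    rw [Matrix.projVandermonde_apply, mul_comm, Fin.val_rev]
    congr 2
    omega
  have h1 : (n.factorial : S) ^ 2 * V n X Y A B =
      ∑ τ : Equiv.Perm (Fin n), ∑ ρ : Equiv.Perm (Fin n), V n X Y A B := by
    simp [Fintype.card_perm, sq, mul_assoc]
  rw [h1]
  simp only [V, Matrix.det_apply']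
  rw [sum_congr rfl fun τ _ => sum_congr rfl fun ρ _ => sum_sign_comp_permHalves _ τ ρ]
  rw [sum_congr rfl fun τ _ => sum_comm]
  rw [sum_comm]
  refine sum_congr rfl fun σ _ => ?_
  rw [sum_congr rfl fun τ _ => (mul_sum _ _ _).symm, ← mul_sum, hV (fun i => X (σ (halves n (.inl i))))
    (fun i => Y (σ (halves n (.inl i)))), hV (fun i => X (σ (halves n (.inr i))))
    (fun i => Y (σ (halves n (.inr i)))), sum_mul_sum]
  refine congrArg _ ?_
  rw [mul_sum]
  refine sum_congr rfl fun τ _ => ?_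
  rw [mul_sum]
  refine sum_congr rfl fun ρ _ => ?_
  rw [← (halves n).prod_comp, Fintype.prod_sum_type]
  have e : ∀ k : Fin n, 2 * n - 1 - (n + (k : ℕ)) = n - 1 - k := fun k => by omega
  simp only [permHalves, Equiv.Perm.mul_apply, Equiv.permCongr_apply, Equiv.symm_apply_apply,
    Equiv.Perm.sumCongr_apply, Sum.map_inl, Sum.map_inr, prod_mul_distrib, Matrix.of_apply,
    halves_inl_val, halves_inr_val, Fin.is_lt, if_true, Nat.not_lt.2 (Nat.le_add_right _ _),
    if_false, e, Nat.add_sub_cancel_left]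
  rw [Equiv.prod_comp τ fun k => A (σ (halves n (.inl k))),
    Equiv.prod_comp ρ fun k => B (σ (halves n (.inr k)))]
  ring

/-- The two expansions agree for each σ. The pairs inside a half supply the factors 1 - t X_i X_j of
the Vandermonde determinants in X and 1 + tX², and the mixed pairs cancel the denominators of
Cauchy's determinant. -/
theorem prod_mul_pairSum {n : ℕ} (t : S) (X A B : Fin (2 * n) → S)
    (h : Fin (2 * n) → Fin (2 * n) → S) (hh : ∀ i j, h i j * (1 - t * X i * X j) = 1) :
    (n.factorial : S) * ((∏ i, ∏ j ∈ Ioi i, (1 - t * X i * X j)) *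
        pairSum n (fun i j => A i * B j * h i j)) =
      (n.factorial : S) ^ 2 * (t ^ n.choose 2 * V n X (fun i => 1 + t * X i ^ 2) A B) := by
  rw [mul_left_comm, factorial_mul_pairSum, mul_left_comm, factorial_sq_mul_V, mul_sum, mul_sum]
  refine sum_congr rfl fun σ _ => ?_
  rw [det_cauchy t n (fun k => X (σ (halves n (.inl k)))) (fun k => X (σ (halves n (.inr k)))) _
    fun i j => hh _ _,
    ← prod_Ioi_comp_perm (fun i j => 1 - t * X i * X j) (fun i j => by ring) σ, prod_Ioi_halves]
  have e1 : (∏ i : Fin n, ∏ j : Fin n, (1 - t * X (σ (halves n (.inl i))) *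
      X (σ (halves n (.inr j))))) * (∏ i : Fin n, ∏ j : Fin n,
      h (σ (halves n (.inl i))) (σ (halves n (.inr j)))) = 1 := by
    simp only [← prod_mul_distrib, mul_comm (1 - t * _ * _), hh, prod_const_one]
  have e2 : ∀ u : Fin n → S, (∏ i, ∏ j ∈ Ioi i,
      (u i * (1 + t * u j ^ 2) - u j * (1 + t * u i ^ 2))) = (-1) ^ n.choose 2 *
      ((∏ i, ∏ j ∈ Ioi i, (1 - t * u i * u j)) * (∏ i, ∏ j ∈ Ioi i, (u j - u i))) := fun u => by
    have hc : (-1 : S) ^ n.choose 2 = ∏ i : Fin n, ∏ j ∈ Ioi i, (-1 : S) := by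
      simp only [prod_const, Fin.card_Ioi, prod_pow_eq_pow_sum]
      congr 1
      rw [Fin.sum_univ_eq_sum_range (fun i => n - 1 - i) n, sum_range_reflect (fun i => i),
        sum_range_id, Nat.choose_two_right]
    rw [hc]
    simp only [← prod_mul_distrib]
    exact prod_congr rfl fun i _ => prod_congr rfl fun j _ => by ring
  rw [e2 fun i => X (σ (halves n (.inl i))), e2 fun i => X (σ (halves n (.inr i)))]
  have e3 : (-1 : S) ^ n.choose 2 * (-1) ^ n.choose 2 = 1 := by rw [← mul_pow]; simp
  simp only [prod_mul_distrib]
  linear_combination (exp := 1) ((Equiv.Perm.sign σ : ℤ) : S) *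
    (∏ k, A (σ (halves n (.inl k)))) * (∏ k, B (σ (halves n (.inr k)))) * t ^ n.choose 2 *
    (∏ i : Fin n, ∏ j ∈ Ioi i, (1 - t * X (σ (halves n (.inl i))) * X (σ (halves n (.inl j))))) *
    (∏ i : Fin n, ∏ j ∈ Ioi i, (1 - t * X (σ (halves n (.inr i))) * X (σ (halves n (.inr j))))) *
    (∏ i : Fin n, ∏ j ∈ Ioi i, (X (σ (halves n (.inl j))) - X (σ (halves n (.inl i))))) *
    (∏ i : Fin n, ∏ j ∈ Ioi i, (X (σ (halves n (.inr j))) - X (σ (halves n (.inr i))))) *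
    (e1 - e3)

end Pairing

/-! ### Alternating sums as powers of a 2-form. -/

open ExteriorAlgebra

/-- The strictly decreasing sequences of `m` natural numbers less than `N`. -/
def decSeqs (m N : ℕ) : Finset (Fin m → ℕ) :=
  open Classical in {l ∈ Fintype.piFinset fun _ => range N | StrictAnti l}

theorem mem_decSeqs {m N : ℕ} {l : Fin m → ℕ} :
    l ∈ decSeqs m N ↔ (∀ j, l j < N) ∧ StrictAnti l := by
  simp [decSeqs]

theorem strictAnti_cons {m N : ℕ} {l : Fin m → ℕ} :
    StrictAnti (Fin.cons N l : Fin (m + 1) → ℕ) ↔ (∀ j, l j < N) ∧ StrictAnti l := by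
  refine ⟨fun h => ⟨fun j => by simpa using h (Fin.succ_pos j), fun i j hij => by
    simpa using h (Fin.succ_lt_succ_iff.2 hij)⟩, fun ⟨h1, h2⟩ i j => ?_⟩
  refine Fin.cases (Fin.cases (by simp) (fun j _ => by simpa using h1 j) j)
    (fun i => Fin.cases (by simp) (fun j hij => ?_) j) i
  simpa using h2 (Fin.succ_lt_succ_iff.1 hij)

theorem sum_decSeqs_succ {A : Type*} [AddCommMonoid A] (m N : ℕ) (f : (Fin (m + 1) → ℕ) → A) :
    ∑ l ∈ decSeqs (m + 1) (N + 1), f l =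
      ∑ l ∈ decSeqs (m + 1) N, f l + ∑ l ∈ decSeqs m N, f (Fin.cons N l) := by
  classical
  have : decSeqs (m + 1) (N + 1) =
      decSeqs (m + 1) N ∪ (decSeqs m N).image (Fin.cons (α := fun _ => ℕ) N) := by
    ext l
    obtain ⟨a, l, rfl⟩ : ∃ a l', l = Fin.cons a l' := ⟨l 0, Fin.tail l, (Fin.cons_self_tail l).symm⟩
    simp only [mem_union, mem_image, mem_decSeqs, strictAnti_cons, Fin.forall_fin_succ,
      Fin.cons_zero, Fin.cons_succ, Fin.cons_inj]
    constructor
    · rintro ⟨⟨h1, h2⟩, h3, h4⟩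
      rcases (Nat.lt_succ_iff.1 h1).lt_or_eq with h | rfl
      · exact Or.inl ⟨⟨h, fun j => (h3 j).trans h⟩, h3, h4⟩
      · exact Or.inr ⟨l, ⟨h3, h4⟩, rfl, rfl⟩
    · rintro (⟨⟨h1, h2⟩, h3, h4⟩ | ⟨l, ⟨h3, h4⟩, rfl, rfl⟩)
      · exact ⟨⟨by omega, fun j => (h2 j).trans (Nat.lt_succ_self _)⟩, h3, h4⟩
      · exact ⟨⟨Nat.lt_succ_self _, fun j => (h3 j).trans (Nat.lt_succ_self _)⟩, h3, h4⟩
  rw [this, sum_union, sum_image]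
  · exact fun l _ l' _ h => (Fin.cons_inj.1 h).2
  · rw [disjoint_left]
    rintro _ h1 h2
    obtain ⟨l, _, rfl⟩ := mem_image.1 h2
    simpa using (mem_decSeqs.1 h1).1 0

section Exterior

variable {S : Type*} [CommRing S]

section Module

variable {M : Type*} [AddCommGroup M] [Module S M]

theorem ι_mul_ι_comm (a b : M) : ι S a * ι S b = -(ι S b * ι S a) :=
  eq_neg_of_add_eq_zero_left (ι_add_mul_swap a b)

theorem commute_ι_mul_ι (a b c : M) : Commute (ι S a * ι S b) (ι S c) := by
  unfold Commute SemiconjBy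
  rw [mul_assoc, ι_mul_ι_comm b c, mul_neg, ← mul_assoc, ι_mul_ι_comm a c, neg_mul, neg_neg,
    mul_assoc]

theorem ι_mul_ιMulti (a : M) : ∀ {n : ℕ} (f : Fin n → M),
    ι S a * ιMulti S n f = (-1) ^ n * (ιMulti S n f * ι S a)
  | 0, f => by simp
  | n + 1, f => by
    rw [ιMulti_succ_apply, ← mul_assoc, ι_mul_ι_comm, neg_mul, mul_assoc, ι_mul_ιMulti a,
      pow_succ' (-1 : ExteriorAlgebra S M)]
    rcases neg_one_pow_eq_or (ExteriorAlgebra S M) n with h | h <;> rw [h] <;> simp [mul_assoc]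

/-- The weights of a strictly decreasing sequence, alternating between `α` and `β`, and ending
with `β`. -/
def altWeight (α β : ℕ → S) (m : ℕ) (l : Fin m → ℕ) : S :=
  ∏ j : Fin m, (if Even (m - (j : ℕ)) then α else β) (l j)

theorem altWeight_cons (α β : ℕ → S) (m N : ℕ) (l : Fin m → ℕ) :
    altWeight α β (m + 1) (Fin.cons N l) =
      (if Even (m + 1) then α else β) N * altWeight α β m l := by
  simp [altWeight, Fin.prod_univ_succ]

/-- The sum of all weighted products of `m` vectors `e l_1, …, e l_m` with
`N > l_1 > ⋯ > l_m`. -/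
def altSum (α β : ℕ → S) (e : ℕ → M) (m N : ℕ) : ExteriorAlgebra S M :=
  ∑ l ∈ decSeqs m N, altWeight α β m l • ιMulti S m fun j => e (l j)

theorem altSum_zero_left (α β : ℕ → S) (e : ℕ → M) (N : ℕ) : altSum α β e 0 N = 1 := by
  have : decSeqs 0 N = {Fin.elim0} := by
    ext l
    simp only [mem_decSeqs, mem_singleton]
    exact ⟨fun _ => Subsingleton.elim _ _, fun _ => ⟨fun j => j.elim0, fun i => i.elim0⟩⟩
  simp [altSum, this, altWeight]

theorem altSum_succ_zero (α β : ℕ → S) (e : ℕ → M) (m : ℕ) : altSum α β e (m + 1) 0 = 0 := by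
  refine sum_eq_zero fun l hl => ?_
  simpa using (mem_decSeqs.1 hl).1 0

theorem altSum_succ_succ (α β : ℕ → S) (e : ℕ → M) (m N : ℕ) :
    altSum α β e (m + 1) (N + 1) = altSum α β e (m + 1) N +
      (if Even (m + 1) then α else β) N • (ι S (e N) * altSum α β e m N) := by
  rw [altSum, sum_decSeqs_succ, altSum, altSum, mul_sum, smul_sum]
  congr 1
  refine sum_congr rfl fun l _ => ?_
  rw [altWeight_cons, mul_smul_comm, smul_smul, ιMulti_succ_apply]
  simp [Function.comp_def, Matrix.vecTail]

/-- `∑_{q < N} β_q e_q`. -/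
def partialVec (β : ℕ → S) (e : ℕ → M) (N : ℕ) : M := ∑ q ∈ range N, β q • e q

/-- `∑_{q < p < N} α_p β_q e_p e_q`. -/
def partialForm (α β : ℕ → S) (e : ℕ → M) (N : ℕ) : ExteriorAlgebra S M :=
  ∑ p ∈ range N, α p • (ι S (e p) * ι S (partialVec β e p))

theorem commute_partialForm (α β : ℕ → S) (e : ℕ → M) (N : ℕ) (a : M) :
    Commute (partialForm α β e N) (ι S a) :=
  Commute.sum_left _ _ _ fun _ _ => (commute_ι_mul_ι _ _ _).smul_left _

theorem add_pow_of_sq_zero {A : Type*} [Ring A] {u w : A} (h : Commute u w) (hw : w * w = 0) :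
    ∀ n : ℕ, (u + w) ^ (n + 1) = u ^ (n + 1) + (n + 1 : ℕ) • (w * u ^ n)
  | 0 => by simp
  | n + 1 => by
    have h1 : u ^ (n + 1) * w = w * u ^ (n + 1) := (h.pow_left _).eq
    have h2 : w * u ^ n * w = 0 := by rw [mul_assoc, (h.pow_left n).eq, ← mul_assoc, hw, zero_mul]
    rw [pow_succ, add_pow_of_sq_zero h hw n, add_mul, mul_add, mul_add, h1, smul_mul_assoc,
      smul_mul_assoc, h2, mul_assoc, ← pow_succ, ← pow_succ, smul_zero, add_zero,
      succ_nsmul _ (n + 1)]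
    abel

/-- Induction on N, with the even and odd lengths carried together. Passing to N + 1 adds to the
form a commuting term of square zero, so its power gains only a linear term; this matches the
sequences whose largest entry is N, whose tails have odd length. -/
theorem partialForm_pow (α β : ℕ → S) (e : ℕ → M) (N : ℕ) : ∀ n : ℕ,
    partialForm α β e N ^ n = n.factorial • altSum α β e (2 * n) N ∧
    ι S (partialVec β e N) * partialForm α β e N ^ n =
      n.factorial • altSum α β e (2 * n + 1) N := by
  induction N with
  | zero =>
    rintro (_ | n)
    · simp [partialVec, altSum_succ_zero, altSum_zero_left]
    · simp [partialVec, partialForm, altSum_succ_zero, Nat.mul_succ]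
  | succ N ih =>
    have hU : partialForm α β e (N + 1) =
        partialForm α β e N + α N • (ι S (e N) * ι S (partialVec β e N)) := sum_range_succ _ _
    have hv : ι S (partialVec β e (N + 1)) = ι S (partialVec β e N) + β N • ι S (e N) := by
      rw [partialVec, sum_range_succ, map_add, map_smul]; rfl
    have hsq : ∀ a b : M, ι S a * ι S b * ι S a = 0 := fun a b => by
      rw [(commute_ι_mul_ι a b a).eq, ← mul_assoc, ι_sq_zero, zero_mul]
    set u := partialForm α β e N
    set w := α N • (ι S (e N) * ι S (partialVec β e N)) with hw
    have hc : Commute u w :=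
      ((commute_partialForm α β e N _).mul_right (commute_partialForm α β e N _)).smul_right _
    have hww : w * w = 0 := by
      rw [hw, smul_mul_assoc, mul_smul_comm, ← mul_assoc, hsq, zero_mul, smul_zero, smul_zero]
    -- Both summands of the new vector already occur as factors of w, so in the odd case the new
    -- part of the form contributes nothing.
    have hvw : ι S (partialVec β e (N + 1)) * w = 0 := by
      rw [hv, hw, add_mul, mul_smul_comm, ← mul_assoc, hsq, smul_mul_assoc, mul_smul_comm,
        ← mul_assoc, ι_sq_zero]
      simp
    have hodd : ∀ n, ι S (partialVec β e (N + 1)) * (u + w) ^ n =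
        n.factorial • altSum α β e (2 * n + 1) (N + 1) := by
      intro n
      have : ι S (partialVec β e (N + 1)) * (u + w) ^ n = ι S (partialVec β e (N + 1)) * u ^ n := by
        rcases n with _ | n
        · simp
        · rw [add_pow_of_sq_zero hc hww, mul_add, mul_smul_comm, ← mul_assoc, hvw]
          simp
      rw [this, hv, add_mul, (ih n).2, smul_mul_assoc, (ih n).1, altSum_succ_succ,
        if_neg (by simp), smul_add, mul_smul_comm, smul_comm]
    rintro (_ | n)
    · exact ⟨by simp [altSum_zero_left], hU ▸ hodd 0⟩
    · refine ⟨?_, hU ▸ hodd (n + 1)⟩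
      rw [hU, add_pow_of_sq_zero hc hww, (ih (n + 1)).1, hw, smul_mul_assoc, mul_assoc, (ih n).2,
        Nat.mul_succ, altSum_succ_succ, if_pos (by simp [parity_simps]), smul_add, mul_smul_comm,
        Nat.factorial_succ, mul_smul, mul_smul, smul_comm (α N)]

end Module

/-! ### Top coefficients of powers of quadratic forms. -/

/-- The coefficient of the top form. -/
def topCoeff (S : Type*) [CommRing S] (m : ℕ) : ExteriorAlgebra S (Fin m → S) →ₗ[S] S :=
  liftAlternating (Pi.single (M := fun i => (Fin m → S) [⋀^Fin i]→ₗ[S] S) m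
    Matrix.detRowAlternating)

theorem topCoeff_ιMulti {m : ℕ} (v : Fin m → Fin m → S) :
    topCoeff S m (ιMulti S m v) = Matrix.det (Matrix.of v) := by
  rw [topCoeff, liftAlternating_apply_ιMulti, Pi.single_eq_same]
  rfl

/-- The quadratic form `∑ c_ij ξ_i ξ_j` in the standard generators `ξ_i`. -/
def quadForm {m : ℕ} (c : Fin m → Fin m → S) : ExteriorAlgebra S (Fin m → S) :=
  ∑ i, ∑ j, c i j • (ι S (Pi.single i 1) * ι S (Pi.single j 1))

/-- The symmetric part of c drops out because the generators anticommute and square to zero. Pairing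
(i, j) with (j, i) avoids any division by 2. -/
theorem quadForm_congr {m : ℕ} {c c' : Fin m → Fin m → S}
    (h : ∀ i j, c i j - c j i = c' i j - c' j i) : quadForm c = quadForm c' := by
  rw [← sub_eq_zero]
  simp only [quadForm, ← sum_sub_distrib, ← sub_smul]
  rw [← sum_product' (s := univ) (t := univ)
    (f := fun i j => (c i j - c' i j) •
      (ι S (Pi.single i 1 : Fin m → S) * ι S (Pi.single j 1 : Fin m → S)))]
  refine sum_involution (fun p _ => p.swap) ?_ ?_ (by simp) (by simp)
  · rintro ⟨i, j⟩ _
    have h1 : c j i - c' j i = c i j - c' i j := by linear_combination -h i j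
    simp only [Prod.fst_swap, Prod.snd_swap]
    rw [h1, ← smul_add, ι_add_mul_swap, smul_zero]
  · rintro ⟨i, j⟩ _ h1 h2
    obtain rfl : j = i := congrArg Prod.fst h2
    exact h1 (by simp)

/-- The sign comes from moving all left factors in front of the right ones: the (n+1)-st step moves
one generator past n others. -/
theorem quadForm_pow {m : ℕ} (c : Fin m → Fin m → S) : ∀ n : ℕ, quadForm c ^ n =
    (-1) ^ n.choose 2 * ∑ F : Fin n → Fin m, ∑ G : Fin n → Fin m, (∏ k, c (F k) (G k)) •
      (ιMulti S n (fun k => Pi.single (F k) 1) * ιMulti S n fun k => Pi.single (G k) 1)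
  | 0 => by simp
  | n + 1 => by
    have hcons : ∀ {A : Type _} [AddCommMonoid A] (f : (Fin (n + 1) → Fin m) → A),
        ∑ F, f F = ∑ i, ∑ F, f (Fin.cons i F) := fun f => by
      rw [← (Fin.consEquiv fun _ => Fin m).sum_comp, Fintype.sum_prod_type]
      rfl
    have hm : ∀ (i : Fin m) (F : Fin n → Fin m),
        ιMulti S (n + 1) (fun k => (Pi.single ((Fin.cons i F : Fin (n + 1) → Fin m) k) 1 :
          Fin m → S)) = ι S (Pi.single i 1) * ιMulti S n fun k => Pi.single (F k) 1 := fun i F => by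
      rw [ιMulti_succ_apply]
      simp [Function.comp_def, Matrix.vecTail]
    have hs : ∀ (k : ℕ) (y : ExteriorAlgebra S (Fin m → S)), (-1) ^ k * y = ((-1 : S) ^ k) • y :=
      fun k y => by rw [Algebra.smul_def]; simp
    rw [pow_succ', quadForm_pow c n, hcons]
    simp only [hcons (fun G => _ • _), hm, Fin.prod_univ_succ, Fin.cons_zero, Fin.cons_succ]
    simp only [quadForm, hs, sum_mul, mul_sum, smul_sum, mul_smul_comm, smul_mul_assoc]
    rw [sum_congr rfl fun i _ => sum_comm]
    rw [sum_comm]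
    refine sum_congr rfl fun i _ => sum_congr rfl fun F _ => sum_comm.trans <|
      sum_congr rfl fun j _ => sum_congr rfl fun G _ => ?_
    have : ι S (Pi.single i 1 : Fin m → S) * ι S (Pi.single j 1) *
        (ιMulti S n (fun k => (Pi.single (F k) 1 : Fin m → S)) *
          ιMulti S n fun k => (Pi.single (G k) 1 : Fin m → S)) = (-1 : S) ^ n •
        (ι S (Pi.single i 1 : Fin m → S) * ιMulti S n (fun k => (Pi.single (F k) 1 : Fin m → S)) *
        (ι S (Pi.single j 1) * ιMulti S n fun k => (Pi.single (G k) 1 : Fin m → S))) := by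
      rw [mul_assoc, ← mul_assoc (ι S (Pi.single j 1)), ι_mul_ιMulti, hs, smul_mul_assoc,
        mul_smul_comm]
      simp only [mul_assoc]
    rw [this]
    simp only [smul_smul]
    congr 1
    rw [Nat.choose_succ_succ' n 1, Nat.choose_one_right, pow_add]
    ring

theorem ιMulti_cast {M : Type*} [AddCommGroup M] [Module S M] {m k : ℕ} (h : m = k)
    (v : Fin m → M) : ιMulti S m v = ιMulti S k fun j => v (Fin.cast h.symm j) := by
  subst h; rfl

theorem topCoeff_quadForm_pow {n : ℕ} (c : Fin (2 * n) → Fin (2 * n) → S) :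
    topCoeff S (2 * n) (quadForm c ^ n) = (-1) ^ n.choose 2 * pairSum n c := by
  have hs : ∀ (k : ℕ) (y : ExteriorAlgebra S (Fin (2 * n) → S)),
      (-1) ^ k * y = ((-1 : S) ^ k) • y := fun k y => by rw [Algebra.smul_def]; simp
  have h1 : ∀ F G : Fin n → Fin (2 * n), topCoeff S (2 * n)
      (ιMulti S n (fun k => Pi.single (F k) 1) * ιMulti S n fun k => Pi.single (G k) 1) =
      ∑ σ : Equiv.Perm (Fin (2 * n)), ((Equiv.Perm.sign σ : ℤ) : S) *
        if F = (fun k => σ (halves n (.inl k))) ∧ G = (fun k => σ (halves n (.inr k)))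
          then 1 else 0 := by
    intro F G
    rw [ιMulti_mul_ιMulti, ιMulti_cast (two_mul n).symm, topCoeff_ιMulti, ← Matrix.det_transpose,
      Matrix.det_apply']
    refine sum_congr rfl fun σ _ => congrArg _ ?_
    rw [← (halves n).prod_comp, Fintype.prod_sum_type]
    have hl : ∀ k : Fin n, Fin.cast (two_mul n) (halves n (.inl k)) = Fin.castAdd n k :=
      fun k => by ext; simp
    have hr : ∀ k : Fin n, Fin.cast (two_mul n) (halves n (.inr k)) = Fin.natAdd n k :=
      fun k => by ext; simp [add_comm]
    simp only [Matrix.transpose_apply, Matrix.of_apply, hl, hr, Fin.append_left, Fin.append_right,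
      Pi.single_apply, prod_ite_zero, prod_const_one, mem_univ, true_imp_iff, funext_iff,
      @eq_comm _ (F _), @eq_comm _ (G _), ite_and, mul_ite, mul_one, mul_zero]
    split_ifs <;> simp_all
  rw [quadForm_pow, hs, map_smul, smul_eq_mul]
  congr 1
  simp only [map_sum, map_smul, smul_eq_mul, h1, pairSum, mul_sum]
  rw [sum_congr rfl fun F _ => sum_comm]
  rw [sum_comm]
  refine sum_congr rfl fun σ _ => ?_
  rw [sum_eq_single fun k => σ (halves n (.inl k)), sum_eq_single fun k => σ (halves n (.inr k))]
  · simp [mul_comm]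
  · intro G _ hG
    simp [hG]
  · simp
  · intro F _ hF
    simp [hF]
  · simp

/-- Both sides are, up to the same sign, top coefficients of powers of one quadratic form. -/
theorem pairSum_congr {n : ℕ} {c c' : Fin (2 * n) → Fin (2 * n) → S}
    (h : ∀ i j, c i j - c j i = c' i j - c' j i) : pairSum n c = pairSum n c' := by
  have h1 := topCoeff_quadForm_pow c
  rw [quadForm_congr h, topCoeff_quadForm_pow] at h1
  have e : (-1 : S) ^ n.choose 2 * (-1) ^ n.choose 2 = 1 := by rw [← mul_pow]; simp
  linear_combination (-1 : S) ^ n.choose 2 * (-h1) - (pairSum n c - pairSum n c') * e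

/-- Each permutation uses every index exactly once. -/
theorem pairSum_mul {n : ℕ} (d : Fin (2 * n) → S) (c : Fin (2 * n) → Fin (2 * n) → S) :
    pairSum n (fun i j => d i * d j * c i j) = (∏ i, d i) * pairSum n c := by
  rw [pairSum, pairSum, mul_sum]
  refine sum_congr rfl fun σ _ => ?_
  rw [← Equiv.prod_comp σ, ← (halves n).prod_comp, Fintype.prod_sum_type]
  simp only [prod_mul_distrib]
  ring

theorem partialForm_eq_quadForm {m : ℕ} (α β : ℕ → S) (x : Fin m → S) (N : ℕ) :
    partialForm α β (fun p i => x i ^ p) N =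
      quadForm fun i j => ∑ p ∈ range N, ∑ q ∈ range p, α p * x i ^ p * (β q * x j ^ q) := by
  have he : ∀ p : ℕ, ι S (fun i => x i ^ p) = ∑ i, x i ^ p • ι S (Pi.single i 1 : Fin m → S) :=
    fun p => by
      rw [pi_eq_sum_univ' (fun i => x i ^ p), map_sum]
      exact sum_congr rfl fun i _ => map_smul _ _ _
  simp only [partialForm, partialVec, map_sum, map_smul, he, quadForm, sum_smul, smul_sum, mul_sum,
    sum_mul, smul_mul_assoc, mul_smul_comm, smul_smul]
  rw [sum_congr rfl fun p _ => sum_congr rfl fun q _ => sum_comm]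
  refine Eq.trans ?_ (sum_comm.trans (sum_congr rfl fun i _ => sum_comm))
  refine sum_congr rfl fun p _ => sum_comm.trans (sum_congr rfl fun i _ => sum_comm.trans
    (sum_congr rfl fun j _ => sum_congr rfl fun q _ => congrArg (· • _) (by ring)))

/-- The top coefficient of `partialForm_pow` for the vectors e_p = (x_i^p)_i, computed in two ways.
-/
theorem factorial_mul_sum_altWeight {n : ℕ} (α β : ℕ → S) (x : Fin (2 * n) → S) (N : ℕ) :
    (n.factorial : S) * ∑ l ∈ decSeqs (2 * n) N, altWeight α β (2 * n) l *
        Matrix.det (Matrix.of fun i j => x i ^ l j) =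
      (-1) ^ n.choose 2 * pairSum n fun i j =>
        ∑ p ∈ range N, ∑ q ∈ range p, α p * x i ^ p * (β q * x j ^ q) := by
  rw [← topCoeff_quadForm_pow, ← partialForm_eq_quadForm, (partialForm_pow α β _ N n).1, map_nsmul,
    nsmul_eq_mul, altSum, map_sum]
  simp only [map_smul, topCoeff_ιMulti, smul_eq_mul]
  refine congrArg _ (sum_congr rfl fun l _ => congrArg _ ?_)
  rw [← Matrix.det_transpose]
  rfl

end Exterior

/-! ### Partitions and strictly decreasing sequences. -/

section Partitions

theorem shifted_strictAnti (m : ℕ) (μ : YoungDiagram) : StrictAnti (shifted m μ) := by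
  intro i j hij
  have h1 := μ.rowLen_anti i j (Fin.le_def.1 hij.le)
  have h2 : (i : ℕ) < j := hij
  have h3 := j.isLt
  simp only [shifted, delta]
  omega

theorem shifted_injOn (m : ℕ) {μ ν : YoungDiagram} (hμ : μ.colLen 0 ≤ m) (hν : ν.colLen 0 ≤ m)
    (h : shifted m μ = shifted m ν) : μ = ν := by
  have hrow : ∀ i < m, μ.rowLen i = ν.rowLen i := fun i hi => by
    simpa [shifted] using congrFun h ⟨i, hi⟩
  have hlt : ∀ {κ : YoungDiagram} {i j : ℕ}, κ.colLen 0 ≤ m → (i, j) ∈ κ → i < m :=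
    fun hκ hij => (YoungDiagram.mem_iff_lt_colLen.1
      (YoungDiagram.up_left_mem _ le_rfl (Nat.zero_le _) hij)).trans_le hκ
  refine YoungDiagram.ext (Finset.ext fun ⟨i, j⟩ => ?_)
  rw [YoungDiagram.mem_cells, YoungDiagram.mem_cells]
  constructor <;> intro hij
  · have := hlt hμ hij
    rw [YoungDiagram.mem_iff_lt_rowLen] at hij ⊢
    rwa [← hrow i this]
  · have := hlt hν hij
    rw [YoungDiagram.mem_iff_lt_rowLen] at hij ⊢
    rwa [hrow i this]

theorem exists_shifted_eq {m : ℕ} {l : Fin m → ℕ} (hl : StrictAnti l) :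
    ∃ μ : YoungDiagram, μ.colLen 0 ≤ m ∧ shifted m μ = l := by
  -- A strictly decreasing sequence of naturals drops by at least 1 per step, so l ≥ δ and l - δ is
  -- weakly decreasing.
  have hstep : ∀ i j : Fin m, i ≤ j → l j + ((j : ℕ) - i) ≤ l i := by
    have key : ∀ d : ℕ, ∀ i j : Fin m, (j : ℕ) = i + d → l j + d ≤ l i := by
      intro d
      induction d with
      | zero =>
        intro i j h
        obtain rfl : j = i := Fin.ext (by simpa using h)
        simp
      | succ d ih =>
        intro i j h
        have hj := j.isLt
        have h1 := ih i ⟨i + d, by omega⟩ rfl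
        have h2 := hl (show (⟨i + d, by omega⟩ : Fin m) < j from Fin.lt_def.2 (by simp; omega))
        omega
    intro i j h
    have h' : (i : ℕ) ≤ j := h
    exact key _ i j (by omega)
  have hdelta : ∀ j : Fin m, delta m j ≤ l j := fun j => by
    have := hstep j ⟨m - 1, by have := j.isLt; omega⟩ (Fin.le_def.2 (by have := j.isLt; simp; omega))
    simp only [delta]
    simp only at this
    omega
  have hs : (List.ofFn fun j => l j - delta m j).SortedGE := by
    refine List.sortedGE_ofFn_iff.2 fun i j hij => ?_
    have h1 := hstep i j hij
    have h2 : (i : ℕ) ≤ j := hij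
    have h3 := j.isLt
    simp only [delta]
    omega
  refine ⟨YoungDiagram.ofRowLens _ hs, ?_, ?_⟩
  · by_contra! h
    obtain ⟨h1, _⟩ := YoungDiagram.mem_ofRowLens.1 (YoungDiagram.mem_iff_lt_colLen.2 h)
    simp at h1
  · funext j
    have h1 := YoungDiagram.rowLen_ofRowLens (hw := hs) (Fin.cast (List.length_ofFn).symm j)
    have h2 := hdelta j
    simp only [Fin.val_cast, Fin.getElem_fin, List.getElem_ofFn] at h1
    rw [shifted, h1]
    simp only [Fin.eta]
    omega

/-- The partitions `μ` with at most `m` parts for which all entries of `μ + δ` are less than `N`. -/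
def boundedPartitions (m N : ℕ) : Finset {μ : YoungDiagram // μ.colLen 0 ≤ m} :=
  (decSeqs m N).preimage (fun μ => shifted m μ)
    fun μ _ ν _ h => Subtype.ext (shifted_injOn m μ.2 ν.2 h)

theorem sum_boundedPartitions {A : Type*} [AddCommMonoid A] (m N : ℕ) (f : (Fin m → ℕ) → A) :
    ∑ μ ∈ boundedPartitions m N, f (shifted m μ) = ∑ l ∈ decSeqs m N, f l := by
  refine sum_preimage _ _ _ f fun l hl hl' => ?_
  obtain ⟨μ, hμ, rfl⟩ := exists_shifted_eq (mem_decSeqs.1 hl).2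
  exact absurd ⟨⟨μ, hμ⟩, rfl⟩ hl'

end Partitions

/-! ### Stanley's weight in terms of the shifted parts. -/

section Weights

variable {R : Type*} [CommRing R]

/-- The weight of an entry of `μ + δ` in an odd position (counted from `1`). -/
def oddWeight (a b : R) (p : ℕ) : R := a ^ (p / 2) * b ^ ((p - 1) / 2)

/-- The weight of an entry of `μ + δ` in an even position (counted from `1`). -/
def evenWeight (c d : R) (q : ℕ) : R := c ^ ((q + 1) / 2) * d ^ (q / 2)

theorem nat_ceil_half (p : ℕ) : ⌈(p : ℚ) / 2⌉₊ = (p + 1) / 2 := by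
  apply le_antisymm
  · rw [Nat.ceil_le, div_le_iff₀ two_pos]
    exact_mod_cast (by omega : p ≤ (p + 1) / 2 * 2)
  · have h := Nat.le_ceil ((p : ℚ) / 2)
    rw [div_le_iff₀ two_pos] at h
    have h' : p ≤ ⌈(p : ℚ) / 2⌉₊ * 2 := by exact_mod_cast h
    omega

theorem nat_floor_half (p : ℕ) : ⌊(p : ℚ) / 2⌋₊ = p / 2 := by
  exact_mod_cast Nat.floor_div_eq_div (K := ℚ) p 2

/-- For 0-based i < n the staircase adds 2(n-1-i) + 1 to part 2i and 2(n-1-i) to part 2i + 1. The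
even amounts give (abcd)^{n-1-i}; the extra 1 explains why the roundings in `oddWeight` differ from
those in ω. -/
theorem altWeight_shifted (a b c d : R) {n : ℕ} {μ : YoungDiagram} (hμ : μ.colLen 0 ≤ 2 * n) :
    altWeight (oddWeight a b) (evenWeight c d) (2 * n) (shifted (2 * n) μ) =
      (a * b * c * d) ^ n.choose 2 * omega a b c d μ := by
  have hzero : ∀ i, μ.colLen 0 ≤ i → μ.rowLen i = 0 := fun i hi => by
    by_contra h
    have := YoungDiagram.mem_iff_lt_colLen.1
      (YoungDiagram.mem_iff_lt_rowLen.2 (Nat.pos_of_ne_zero h))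
    omega
  have hsum : ∀ (f : ℕ → ℕ) (s : ℕ), f 0 = 0 →
      ∑ i ∈ range (μ.colLen 0), f (μ.rowLen (2 * i + s)) =
        ∑ i ∈ range n, f (μ.rowLen (2 * i + s)) := fun f s hf => by
    rcases le_total (μ.colLen 0) n with h | h
    · refine sum_subset (range_subset_range.2 h) fun i _ hi => ?_
      rw [hzero _ (by simp at hi; omega), hf]
    · refine (sum_subset (range_subset_range.2 h) fun i _ hi => ?_).symm
      rw [hzero _ (by simp at hi; omega), hf]
  have hprod : ∀ (m : ℕ) (F : ℕ → R), ∏ j : Fin (2 * m), F j =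
      ∏ i ∈ range m, (F (2 * i) * F (2 * i + 1)) := fun m F => by
    rw [Fin.prod_univ_eq_prod_range F (2 * m)]
    induction m with
    | zero => simp
    | succ m ih => rw [Nat.mul_succ, prod_range_succ, prod_range_succ, ih, prod_range_succ, mul_assoc]
  have hC : n.choose 2 = ∑ i ∈ range n, (n - 1 - i) := by
    rw [sum_range_reflect (fun i => i), sum_range_id, Nat.choose_two_right]
  have h1 := hsum (fun p => (p + 1) / 2) 0 rfl
  have h2 := hsum (fun p => p / 2) 0 rfl
  have h3 := hsum (fun p => (p + 1) / 2) 1 rfl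
  have h4 := hsum (fun p => p / 2) 1 rfl
  simp only [add_zero] at h1 h2
  rw [omega]
  simp only [nat_ceil_half, nat_floor_half]
  rw [h1, h2, h3, h4, hC]
  have h5 := hprod n fun j => (if Even (2 * n - j) then oddWeight a b else evenWeight c d)
    (μ.rowLen j + (2 * n - 1 - j))
  simp only [altWeight, shifted, delta]
  rw [h5]
  simp only [← prod_pow_eq_pow_sum, ← prod_mul_distrib]
  refine prod_congr rfl fun i hi => ?_
  have hi := mem_range.1 hi
  rw [if_pos ⟨n - i, by omega⟩, if_neg (by rw [Nat.not_even_iff]; omega), oddWeight, evenWeight]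
  have e1 : (μ.rowLen (2 * i) + (2 * n - 1 - 2 * i)) / 2 =
      (n - 1 - i) + (μ.rowLen (2 * i) + 1) / 2 := by omega
  have e2 : (μ.rowLen (2 * i) + (2 * n - 1 - 2 * i) - 1) / 2 =
      (n - 1 - i) + μ.rowLen (2 * i) / 2 := by omega
  have e3 : (μ.rowLen (2 * i + 1) + (2 * n - 1 - (2 * i + 1)) + 1) / 2 =
      (n - 1 - i) + (μ.rowLen (2 * i + 1) + 1) / 2 := by omega
  have e4 : (μ.rowLen (2 * i + 1) + (2 * n - 1 - (2 * i + 1))) / 2 =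
      (n - 1 - i) + μ.rowLen (2 * i + 1) / 2 := by omega
  rw [e1, e2, e3, e4]
  simp only [pow_add, mul_pow]
  ring

/-- The recursion starts at index 1: truncated subtraction spoils it at 0, which never matters since
no q < 0 exists. -/
theorem oddWeight_add (a b : R) (p : ℕ) :
    oddWeight a b (p + 3) = a * b * oddWeight a b (p + 1) := by
  have e1 : (p + 3) / 2 = (p + 1) / 2 + 1 := by omega
  have e2 : (p + 3 - 1) / 2 = (p + 1 - 1) / 2 + 1 := by omega
  rw [oddWeight, oddWeight, e1, e2]
  ring

theorem evenWeight_add (c d : R) (q : ℕ) :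
    evenWeight c d (q + 2) = c * d * evenWeight c d q := by
  have e1 : (q + 2 + 1) / 2 = (q + 1) / 2 + 1 := by omega
  have e2 : (q + 2) / 2 = q / 2 + 1 := by omega
  rw [evenWeight, evenWeight, e1, e2]
  ring

/-- Partial sums of `∑_{q < p} A_p B_q` for two sequences that are geometric with period `2`. -/
theorem sum_sum_geometric {A B : ℕ → R} {U W : R} (hA : ∀ p, A (p + 3) = U * A (p + 1))
    (hB : ∀ q, B (q + 2) = W * B q) (N : ℕ) :
    (1 - U * W) * (1 - U) * ∑ p ∈ range (N + 1), ∑ q ∈ range p, A p * B q +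
      ((1 - U * W) * (∑ q ∈ range (N + 1), B q) * (A (N + 1) + A (N + 2)) +
        B (N + 1) * (A (N + 2) + A (N + 3)) + B (N + 2) * (A (N + 3) + A (N + 4))) =
      B 0 * (A 1 + A 2) + B 1 * (A 2 + A 3) := by
  -- The right-hand side is the numerator of the full double sum: the tail of A beyond q is (A_{q+1}
  -- + A_{q+2}) / (1 - U), and the sum over q then has ratio UW. The correction terms all contain
  -- some A_p with p > N.
  induction N with
  | zero =>
    have h1 := hA 0
    have h2 := hA 1
    have h3 := hB 0
    simp only [zero_add] at h1 h2 h3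
    simp only [zero_add, range_one, sum_singleton, range_zero, sum_empty, h1, h2, h3]
    ring
  | succ N ih =>
    rw [← ih, sum_range_succ _ (N + 1), sum_range_succ B (N + 1), ← mul_sum, hA (N + 2), hA (N + 1),
      hA N, hB (N + 1)]
    ring

end Weights

/-! ### Truncation modulo high degree. -/

section PowerSeries

variable {σ R : Type*} [CommRing R]

/-- The power series all of whose terms have degree at least `N`. -/
def highDegree (σ R : Type*) [CommRing R] (N : ℕ) : Ideal (MvPowerSeries σ R) where
  carrier := {f | ∀ e : σ →₀ ℕ, e.degree < N → MvPowerSeries.coeff e f = 0}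
  add_mem' hf hg e he := by rw [map_add, hf e he, hg e he, add_zero]
  zero_mem' e _ := map_zero _
  smul_mem' f g hg e he := by
    classical
    rw [smul_eq_mul, MvPowerSeries.coeff_mul]
    refine sum_eq_zero fun p hp => ?_
    rw [hg p.2 (lt_of_le_of_lt ?_ he), mul_zero]
    rw [← mem_antidiagonal.1 hp, map_add]
    exact Nat.le_add_left _ _

theorem X_pow_mem_highDegree (s : σ) {N p : ℕ} (h : N ≤ p) :
    (MvPowerSeries.X s : MvPowerSeries σ R) ^ p ∈ highDegree σ R N := fun e he => by
  classical
  rw [MvPowerSeries.coeff_X_pow, if_neg]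
  rintro rfl
  simp at he
  omega

theorem eq_zero_of_forall_mem_highDegree {f : MvPowerSeries σ R}
    (h : ∀ N, f ∈ highDegree σ R N) : f = 0 :=
  MvPowerSeries.ext fun e => h (e.degree + 1) e (Nat.lt_succ_self _)

theorem pairSum_sub_mem {S : Type*} [CommRing S] (I : Ideal S) {n : ℕ}
    {c c' : Fin (2 * n) → Fin (2 * n) → S} (h : ∀ i j, c i j - c' i j ∈ I) :
    pairSum n c - pairSum n c' ∈ I := by
  have h' : ∀ i j, Ideal.Quotient.mk I (c i j) = Ideal.Quotient.mk I (c' i j) :=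
    fun i j => Ideal.Quotient.eq.2 (h i j)
  refine Ideal.Quotient.eq.1 ?_
  simp only [pairSum, map_sum, map_mul, map_prod, h']

/-- Integral polynomials as power series over `R`. -/
def polyToSeries (m : ℕ) (R : Type*) [CommRing R] :
    MvPolynomial (Fin m) ℤ →+* MvPowerSeries (Fin m) R :=
  MvPolynomial.coeToMvPowerSeries.ringHom.comp (MvPolynomial.map (Int.castRingHom R))

theorem polyToSeries_alternant (m : ℕ) (α : Fin m → ℕ) : polyToSeries m R (alternant m α) =
    Matrix.det (Matrix.of fun i j => (MvPowerSeries.X i : MvPowerSeries (Fin m) R) ^ α j) := by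
  rw [alternant, RingHom.map_det]
  congr 1
  ext1 i j
  simp [polyToSeries]

/-- The part of `weightedSchurSum` coming from `boundedPartitions`. -/
def truncatedSchurSum (a b c d : R) (m N : ℕ) : MvPowerSeries (Fin m) R :=
  ∑ μ ∈ boundedPartitions m N, MvPowerSeries.C (omega a b c d μ) * polyToSeries m R (schur m μ)

/-- By homogeneity, a monomial of degree less than N only meets partitions with all parts less than
N; the staircase adds at most m - 1. -/
theorem weightedSchurSum_sub_mem (a b c d : R) (m N : ℕ) :
    weightedSchurSum a b c d m - truncatedSchurSum a b c d m (N + m) ∈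
      highDegree (Fin m) R N := by
  intro e he
  rw [map_sub, sub_eq_zero]
  have h1 : MvPowerSeries.coeff e (truncatedSchurSum a b c d m (N + m)) =
      ∑ μ ∈ boundedPartitions m (N + m), termCoeff a b c d m e μ := by
    rw [truncatedSchurSum, map_sum]
    refine sum_congr rfl fun μ _ => ?_
    rw [MvPowerSeries.coeff_C_mul]
    simp [polyToSeries, termCoeff, MvPolynomial.coeff_map]
  rw [h1]
  refine finsum_eq_sum_of_support_subset _ fun μ hμ => ?_
  by_contra hmem
  refine hμ ?_
  have hc : MvPolynomial.coeff e (schur m μ) = 0 := by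
    refine (schur_isHomogeneous m μ).coeff_eq_zero fun hdeg => hmem ?_
    refine Finset.mem_coe.2 (Finset.mem_preimage.2 (mem_decSeqs.2 ⟨fun j => ?_, shifted_strictAnti m _⟩))
    have hle : (μ : YoungDiagram).rowLen j ≤ ∑ j : Fin m, (μ : YoungDiagram).rowLen j :=
      single_le_sum (f := fun j : Fin m => (μ : YoungDiagram).rowLen j)
        (fun _ _ => Nat.zero_le _) (mem_univ j)
    have := j.isLt
    simp only [shifted, delta]
    omega
  simp [termCoeff, hc]

theorem alternant_mul_truncatedSchurSum (a b c d : R) (n N : ℕ) :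
    MvPowerSeries.C ((a * b * c * d) ^ n.choose 2) * ((∏ i : Fin (2 * n), ∏ j ∈ Ioi i,
        (MvPowerSeries.X i - MvPowerSeries.X j)) * truncatedSchurSum a b c d (2 * n) N) =
      ∑ l ∈ decSeqs (2 * n) N,
        MvPowerSeries.C (altWeight (oddWeight a b) (evenWeight c d) (2 * n) l) *
        Matrix.det (Matrix.of fun i j =>
          (MvPowerSeries.X i : MvPowerSeries (Fin (2 * n)) R) ^ l j) := by
  have hΔ : ∏ i : Fin (2 * n), ∏ j ∈ Ioi i,
      (MvPowerSeries.X i - MvPowerSeries.X j : MvPowerSeries (Fin (2 * n)) R) =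
      polyToSeries (2 * n) R (alternant (2 * n) (delta (2 * n))) := by
    rw [alternant_delta]
    simp only [map_prod, map_sub]
    simp [polyToSeries]
  rw [hΔ, ← sum_boundedPartitions, truncatedSchurSum, mul_sum, mul_sum]
  refine sum_congr rfl fun μ _ => ?_
  rw [altWeight_shifted a b c d μ.2, ← polyToSeries_alternant, ← alternant_delta_mul_schur _ _ μ.2,
    map_mul, map_mul]
  ring

end PowerSeries

/-! ### The generating function of the weights. -/

section Series

variable {R : Type*} [CommRing R]

theorem isUnit_of_constantCoeff_eq_one {σ : Type*} {f : MvPowerSeries σ R}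
    (h : MvPowerSeries.constantCoeff f = 1) : IsUnit f :=
  MvPowerSeries.isUnit_iff_constantCoeff.2 (h ▸ isUnit_one)

/-- The truncated generating function of the weights, multiplied by its denominator. -/
theorem generating_function_sub_mem (a b c d : R) {m : ℕ} (i j : Fin m) (N : ℕ) :
    let k : R →+* MvPowerSeries (Fin m) R := MvPowerSeries.C
    let x : Fin m → MvPowerSeries (Fin m) R := fun i => MvPowerSeries.X i
    (1 - k (a * b * c * d) * x i ^ 2 * x j ^ 2) * (1 - k (a * b) * x i ^ 2) *
      (∑ p ∈ range (N + 1), ∑ q ∈ range p,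
        k (oddWeight a b p) * x i ^ p * (k (evenWeight c d q) * x j ^ q)) -
      (x i + k a * x i ^ 2 + k c * x j * (k a * x i ^ 2 + k (a * b) * x i ^ 3)) ∈
        highDegree (Fin m) R N := by
  intro k x
  have hU := sum_sum_geometric (A := fun p => k (oddWeight a b p) * x i ^ p)
    (B := fun q => k (evenWeight c d q) * x j ^ q) (U := k (a * b) * x i ^ 2)
    (W := k (c * d) * x j ^ 2)
    (fun p => by simp only [oddWeight_add, map_mul]; ring)
    (fun q => by simp only [evenWeight_add, map_mul]; ring) N
  have hx : ∀ p, N ≤ p → k (oddWeight a b p) * x i ^ p ∈ highDegree (Fin m) R N :=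
    fun p hp => Ideal.mul_mem_left _ _ (X_pow_mem_highDegree i hp)
  have hρ := (highDegree (Fin m) R N).add_mem ((highDegree (Fin m) R N).add_mem
    (Ideal.mul_mem_left _ ((1 - k (a * b) * x i ^ 2 * (k (c * d) * x j ^ 2)) *
      ∑ q ∈ range (N + 1), k (evenWeight c d q) * x j ^ q)
      ((highDegree (Fin m) R N).add_mem (hx (N + 1) (by omega)) (hx (N + 2) (by omega))))
    (Ideal.mul_mem_left _ (k (evenWeight c d (N + 1)) * x j ^ (N + 1))
      ((highDegree (Fin m) R N).add_mem (hx (N + 2) (by omega)) (hx (N + 3) (by omega)))))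
    (Ideal.mul_mem_left _ (k (evenWeight c d (N + 2)) * x j ^ (N + 2))
      ((highDegree (Fin m) R N).add_mem (hx (N + 3) (by omega)) (hx (N + 4) (by omega))))
  convert neg_mem hρ using 1
  have e1 : oddWeight a b 1 = 1 := by simp [oddWeight]
  have e2 : oddWeight a b 2 = a := by simp [oddWeight]
  have e3 : oddWeight a b 3 = a * b := by simp [oddWeight]
  have e4 : evenWeight c d 0 = 1 := by simp [evenWeight]
  have e5 : evenWeight c d 1 = c := by simp [evenWeight]
  simp only [e1, e2, e3, e4, e5] at hU
  simp only [map_mul, map_one] at hU ⊢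
  linear_combination hU

end Series

/-! ### The identity in characteristic zero with abcd ≠ 0. -/

section Domain

variable {R : Type*} [CommRing R] [IsDomain R]

/-- The hypotheses allow n! and (abcd)^{n choose 2} to be cancelled. The identity is proved modulo
every degree N. -/
theorem prod_sub_mul_z_of_charZero [CharZero R] (a b c d : R) (ht : a * b * c * d ≠ 0) (n : ℕ) :
    let k : R →+* MvPowerSeries (Fin (2 * n)) R := MvPowerSeries.C
    let x : Fin (2 * n) → MvPowerSeries (Fin (2 * n)) R := fun i => MvPowerSeries.X i
    (∏ i, (1 - k (a * b) * x i ^ 2)) *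
        (∏ i, ∏ j ∈ Ioi i, (x i - x j) * (1 - k (a * b * c * d) * x i ^ 2 * x j ^ 2)) *
        z a b c d n =
      (-1) ^ n.choose 2 * V n (fun i => x i ^ 2) (fun i => 1 + k (a * b * c * d) * x i ^ 4)
        (fun i => x i + k a * x i ^ 2)
        (fun i => 1 - k (a * (b + c)) * x i ^ 2 - k (a * b * c) * x i ^ 3) := by
  intro k x
  set t := a * b * c * d
  have hunit : ∀ i j, ∃ h, h * (1 - k t * x i ^ 2 * x j ^ 2) = 1 := fun i j =>
    (isUnit_of_constantCoeff_eq_one (by simp [x, k])).exists_left_inv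
  choose h hh using hunit
  have hsymm : ∀ i j, h i j = h j i := fun i j => by
    linear_combination h i j * (-hh j i) + h j i * hh i j
  have hfact : ((n.factorial : ℕ) : MvPowerSeries (Fin (2 * n)) R) ≠ 0 := by
    rw [← map_natCast (MvPowerSeries.C (σ := Fin (2 * n)) (R := R)), Ne,
      ← map_zero (MvPowerSeries.C (σ := Fin (2 * n)) (R := R)), MvPowerSeries.C_injective.eq_iff]
    exact_mod_cast n.factorial_ne_zero
  have hk : k t ^ n.choose 2 ≠ 0 := by
    refine pow_ne_zero _ ?_
    rw [Ne, ← map_zero k, MvPowerSeries.C_injective.eq_iff]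
    exact ht
  set A : Fin (2 * n) → MvPowerSeries (Fin (2 * n)) R := fun i => x i + k a * x i ^ 2 with hA
  set B : Fin (2 * n) → MvPowerSeries (Fin (2 * n)) R :=
    fun i => 1 - k (a * (b + c)) * x i ^ 2 - k (a * b * c) * x i ^ 3 with hB
  set D₁ := ∏ i, (1 - k (a * b) * x i ^ 2) with hD₁
  set D₂ := ∏ i, ∏ j ∈ Ioi i, (1 - k t * x i ^ 2 * x j ^ 2) with hD₂
  set Δ := ∏ i, ∏ j ∈ Ioi i, (x i - x j) with hΔ
  set W := V n (fun i => x i ^ 2) (fun i => 1 + k t * x i ^ 4) A B with hW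
  clear_value A B D₁ D₂ Δ W
  have hV : D₂ * pairSum n (fun i j => A i * B j * h i j) =
      (n.factorial : MvPowerSeries (Fin (2 * n)) R) * (k t ^ n.choose 2 * W) := by
    refine mul_left_cancel₀ hfact ?_
    have hY : (fun i => 1 + k t * (x i ^ 2) ^ 2) = fun i => 1 + k t * x i ^ 4 :=
      funext fun i => by rw [← pow_mul]
    have h0 := prod_mul_pairSum (k t) (fun i => x i ^ 2) A B h hh
    rw [hY, ← hW, ← hD₂] at h0
    rw [h0, sq, mul_assoc]
  -- The two kernels differ by a symmetric function of i and j.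
  have hker : pairSum n (fun i j => (1 - k (a * b) * x j ^ 2) *
      (x i + k a * x i ^ 2 + k c * x j * (k a * x i ^ 2 + k (a * b) * x i ^ 3)) * h i j) =
      pairSum n (fun i j => A i * B j * h i j) := by
    refine pairSum_congr fun i j => ?_
    rw [hsymm j i]
    simp only [hA, hB, map_mul, map_add]
    ring
  have hprod : ∏ i, ∏ j ∈ Ioi i, (x i - x j) * (1 - k t * x i ^ 2 * x j ^ 2) = Δ * D₂ := by
    simp only [prod_mul_distrib, hΔ, hD₂]
  rw [hprod]
  refine mul_left_cancel₀ (mul_ne_zero hfact hk) (sub_eq_zero.1 ?_)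
  refine eq_zero_of_forall_mem_highDegree fun N => ?_
  -- The bound N + 2n + 1 serves both truncations: entries of λ + δ need at least N + 2n, and
  -- `generating_function_sub_mem` sums over a range of successor form.
  have h1 : weightedSchurSum a b c d (2 * n) - truncatedSchurSum a b c d (2 * n) (N + 2 * n + 1) ∈
      highDegree (Fin (2 * n)) R N := by
    rw [show N + 2 * n + 1 = N + 1 + 2 * n by ring]
    exact fun e he => weightedSchurSum_sub_mem a b c d (2 * n) (N + 1) e
      (he.trans (Nat.lt_succ_self N))
  set Z := truncatedSchurSum a b c d (2 * n) (N + 2 * n + 1)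
  set r : Fin (2 * n) → Fin (2 * n) → MvPowerSeries (Fin (2 * n)) R := fun i j =>
    ∑ p ∈ range (N + 2 * n + 1), ∑ q ∈ range p,
      k (oddWeight a b p) * x i ^ p * (k (evenWeight c d q) * x j ^ q) with hr
  have h2 : (n.factorial : MvPowerSeries (Fin (2 * n)) R) * (k t ^ n.choose 2 * (Δ * Z)) =
      (-1) ^ n.choose 2 * pairSum n r := by
    rw [hr, ← factorial_mul_sum_altWeight (fun p => k (oddWeight a b p))
      (fun q => k (evenWeight c d q)) x, ← map_pow, hΔ]
    refine congrArg _ ((alternant_mul_truncatedSchurSum a b c d n _).trans (sum_congr rfl fun l _ => congrArg₂ _ ?_ rfl))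
    rw [altWeight, altWeight, map_prod]
    refine prod_congr rfl fun j _ => ?_
    split_ifs <;> rfl
  have h3 : D₁ * pairSum n r - pairSum n (fun i j => A i * B j * h i j) ∈
      highDegree (Fin (2 * n)) R N := by
    -- Distributing ∏(1 - ab x_i²) over the pairs gives each kernel entry both factors: that of i
    -- clears the denominator of the generating function, that of j is the one in `hker`.
    rw [hD₁, ← pairSum_mul, ← hker]
    refine pairSum_sub_mem _ fun i j => ?_
    have h4 := generating_function_sub_mem a b c d i j (N + 2 * n)
    have h5 := Ideal.mul_mem_left _ ((1 - k (a * b) * x j ^ 2) * h i j) h4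
    have h6 : ∀ f ∈ highDegree (Fin (2 * n)) R (N + 2 * n), f ∈ highDegree (Fin (2 * n)) R N :=
      fun f hf e he => hf e (by omega)
    convert h6 _ h5 using 1
    change _ = (1 - k (a * b) * x j ^ 2) * h i j *
      ((1 - k t * x i ^ 2 * x j ^ 2) * (1 - k (a * b) * x i ^ 2) * r i j - _)
    linear_combination -(1 - k (a * b) * x i ^ 2) * (1 - k (a * b) * x j ^ 2) * r i j * hh i j
  have h7 := (highDegree (Fin (2 * n)) R N).add_mem
    (Ideal.mul_mem_left _ (n.factorial * k t ^ n.choose 2 * D₁ * Δ * D₂) h1)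
    (Ideal.mul_mem_left _ ((-1) ^ n.choose 2 * D₂) h3)
  convert h7 using 1
  rw [z]
  linear_combination (-1) ^ n.choose 2 * hV + D₁ * D₂ * h2

end Domain

/-! ### Specialization from ℤ[a,b,c,d]. -/

section Transfer

variable {R R' : Type*} [CommRing R] [CommRing R']

theorem map_z (φ : R →+* R') (a b c d : R) (n : ℕ) :
    MvPowerSeries.map φ (z a b c d n) = z (φ a) (φ b) (φ c) (φ d) n := by
  ext e
  rw [MvPowerSeries.coeff_map]
  change φ (∑ᶠ μ : {μ : YoungDiagram // μ.colLen 0 ≤ 2 * n}, termCoeff a b c d (2 * n) e μ) =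
    ∑ᶠ μ : {μ : YoungDiagram // μ.colLen 0 ≤ 2 * n}, termCoeff (φ a) (φ b) (φ c) (φ d) (2 * n) e μ
  rw [map_finsum φ (finite_support_termCoeff a b c d (2 * n) e)]
  simp [termCoeff, omega]

theorem map_V (φ : R →+* R') (n : ℕ) (X Y A B : Fin (2 * n) → R) :
    φ (V n X Y A B) = V n (fun i => φ (X i)) (fun i => φ (Y i)) (fun i => φ (A i))
      fun i => φ (B i) := by
  rw [V, RingHom.map_det]
  congr 1
  ext1 i j
  simp only [RingHom.mapMatrix_apply, Matrix.map_apply, Matrix.of_apply]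
  split_ifs <;> simp

/-- With all denominators cleared, the identity is preserved by ring homomorphisms, so it follows
from the case of four indeterminates over ℤ, where n! and abcd are nonzero. -/
theorem prod_sub_mul_z (a b c d : R) (n : ℕ) :
    let k : R →+* MvPowerSeries (Fin (2 * n)) R := MvPowerSeries.C
    let x : Fin (2 * n) → MvPowerSeries (Fin (2 * n)) R := fun i => MvPowerSeries.X i
    (∏ i, (1 - k (a * b) * x i ^ 2)) *
        (∏ i, ∏ j ∈ Ioi i, (x i - x j) * (1 - k (a * b * c * d) * x i ^ 2 * x j ^ 2)) *
        z a b c d n =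
      (-1) ^ n.choose 2 * V n (fun i => x i ^ 2) (fun i => 1 + k (a * b * c * d) * x i ^ 4)
        (fun i => x i + k a * x i ^ 2)
        (fun i => 1 - k (a * (b + c)) * x i ^ 2 - k (a * b * c) * x i ^ 3) := by
  intro k x
  let g : Fin 4 → MvPolynomial (Fin 4) ℤ := MvPolynomial.X
  let φ : MvPolynomial (Fin 4) ℤ →+* R := MvPolynomial.eval₂Hom (Int.castRingHom R) ![a, b, c, d]
  have hφ : ∀ i, φ (g i) = ![a, b, c, d] i := fun i => MvPolynomial.eval₂Hom_X' _ _ _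
  have ha : φ (g 0) = a := hφ 0
  have hb : φ (g 1) = b := hφ 1
  have hc : φ (g 2) = c := hφ 2
  have hd : φ (g 3) = d := hφ 3
  have hg : ∀ i, g i ≠ 0 := fun i => MvPolynomial.X_ne_zero i
  have h := congrArg (MvPowerSeries.map φ) (prod_sub_mul_z_of_charZero (g 0) (g 1) (g 2) (g 3)
    (mul_ne_zero (mul_ne_zero (mul_ne_zero (hg 0) (hg 1)) (hg 2)) (hg 3)) n)
  simpa only [map_mul, map_prod, map_sub, map_add, map_one, map_pow, map_neg, map_z, map_V,
    MvPowerSeries.map_C, MvPowerSeries.map_X, ha, hb, hc, hd, k, x] using h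

end Transfer
end StanleySchur
end

/-! ### The theorem in the field of fractions. -/

theorem mainTheorem4 {R : Type*} [CommRing R] [IsDomain R] (a b c d : R) (n : ℕ) :
    let S := MvPowerSeries (Fin (2 * n)) R
    let frac : S →+* FractionRing S := algebraMap S (FractionRing S)
    let k : R →+* S := MvPowerSeries.C
    let x : Fin (2 * n) → S := fun i => MvPowerSeries.X i
    let denominator : S :=
      (∏ i, (1 - k (a * b) * x i ^ 2)) *
        ∏ i, ∏ j ∈ Finset.Ioi i,
          (x i - x j) * (1 - k (a * b * c * d) * x i ^ 2 * x j ^ 2)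
    denominator ≠ 0 ∧
      frac (StanleySchur.z a b c d n) =
        (-1) ^ (n.choose 2) *
          frac (StanleySchur.V n (fun i => x i ^ 2) (fun i => 1 + k (a * b * c * d) * x i ^ 4)
            (fun i => x i + k a * x i ^ 2)
            (fun i => 1 - k (a * (b + c)) * x i ^ 2 - k (a * b * c) * x i ^ 3)) /
          frac denominator := by
  intro S frac k x denominator
  have hden : denominator ≠ 0 := by
    refine mul_ne_zero (Finset.prod_ne_zero_iff.2 fun i _ => ?_) (Finset.prod_ne_zero_iff.2
      fun i _ => Finset.prod_ne_zero_iff.2 fun j hj => mul_ne_zero ?_ ?_)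
    · exact (StanleySchur.isUnit_of_constantCoeff_eq_one (by simp [x, k])).ne_zero
    · exact sub_ne_zero.2 fun h => (Finset.mem_Ioi.1 hj).ne (MvPowerSeries.X_inj.1 h)
    · exact (StanleySchur.isUnit_of_constantCoeff_eq_one (by simp [x, k])).ne_zero
  have hfrac : frac denominator ≠ 0 := fun h =>
    hden (IsFractionRing.injective S (FractionRing S) (h.trans (map_zero frac).symm))
  refine ⟨hden, ?_⟩
  have h := congrArg frac (StanleySchur.prod_sub_mul_z a b c d n)
  rw [eq_div_iff hfrac, mul_comm (frac _), ← map_mul]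
  refine h.trans ?_
  rw [map_mul, map_pow, map_neg, map_one]
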